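/- Let $a,b\in\mathbb{R}$ with $b\ge 0$, and let the polynomials $H_m(z)\in\mathbb{R}[z]$, $m=0,1,2,\dots$, be defined by the generating function (an identity of formal power series in $t$) $$\sum_{m=0}^{\infty}H_m(z)\,t^m=\frac{1}{1+t+at^2+zt^2(t-b)}.$$ Then all complex zeros of $H_m(z)$ are real for every $m\ge 0$ if and only if $$1+a+b\ge 0\qquad\text{and}\qquad 9-27a+b\ge 0.$$ -/

import Mathlib

open Polynomial

noncomputable section

/-- The denominator `D(t,z) = 1 + t + a t² + z t² (t - b)`, as a formal power series in `t`
(the variable `PowerSeries.X`) whose coefficients are real polynomials in `z`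
(the variable `Polynomial.X`). -/
def denomD (a b : ℝ) : PowerSeries ℝ[X] :=
  1 + PowerSeries.X + PowerSeries.C (C a) * PowerSeries.X ^ 2
    + PowerSeries.C (X : ℝ[X]) * PowerSeries.X ^ 2 * (PowerSeries.X - PowerSeries.C (C b))

/-- `D(t,z)` has constant coefficient `1` (in `t`), so it is invertible as a power series. -/
theorem constantCoeff_denomD (a b : ℝ) : PowerSeries.constantCoeff (denomD a b) = 1 := by
  simp [denomD]

/-- The polynomial `H_m(z)`: the coefficient of `t ^ m` in the power series `1 / D(t,z)`. -/
def polyH (a b : ℝ) (m : ℕ) : ℝ[X] :=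
  PowerSeries.coeff m (PowerSeries.invOfUnit (denomD a b) 1)

/-- The generating function identity `(∑ H_m(z) t ^ m) * D(t,z) = 1`. -/
theorem mk_polyH_mul_denomD (a b : ℝ) : PowerSeries.mk (polyH a b) * denomD a b = 1 := by
  have h : PowerSeries.mk (polyH a b) = PowerSeries.invOfUnit (denomD a b) 1 := by
    ext1 m
    simp [polyH]
  rw [h, mul_comm]
  exact PowerSeries.mul_invOfUnit _ _ (by simp [constantCoeff_denomD])

end

/-!
The recurrence for `H_m` has the characteristic roots `-y`, where `y` runs through the roots of
`y ^ 3 - y ^ 2 + (a - b z) y - z` (`recipCubic`). Everything depends on how the moduli of these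
three roots compare for real `z`.

*Sufficiency.* Write the roots as `e ^ (± i φ) / r` and `η / r`. Comparing coefficients, this is
possible for real `z` exactly when `r = 2 cos φ + η`, `z = η / r ^ 3` and `branchEq a b (cos φ) η = 0`.
The two conditions on `a` and `b` are what makes `branchEq` change sign between the ends of the range
of `η`, so that it has a zero with `|η| < 1`; it is unique, hence continuous in `φ`
(`exists_continuousOn_branch`), and `φ ↦ z` is injective (`branch_param_injective`). In the partial
fraction formula `aeval_polyH_trig` the conjugate pair dominates at the nodes `φ = i π / (m + 2)`, and
`H_m` alternates in sign there. This produces at least `deg H_m - 1` distinct real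
zeros, and a remaining zero is then real because nonreal zeros come in pairs.

*Necessity.* If a condition fails, the intermediate value theorem gives a real `z` at which the
three roots have equal modulus `ρ`. Near `z` the functions `u ↦ H_m(z + u / m) / ρ ^ m` converge along
a subsequence to an exponential sum with three frequencies (`expSum_norm_re_le`). If every `H_m` has
only real zeros, then `|H_m(Re w)| ≤ |H_m(w)|` for all `w` (`norm_aeval_re_le`), and the limit inherits
this inequality. But the real root moves at a different logarithmic rate than the conjugate pair,
and the pair rotates, so that the inequality fails (`exists_exp_sum_norm_lt`).
-/

/-! ### Recurrence and degree of the polynomials -/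

theorem polyH_zero (a b : ℝ) : polyH a b 0 = 1 := by
  have h := congrArg (PowerSeries.coeff 0) (mk_polyH_mul_denomD a b)
  simpa [PowerSeries.coeff_zero_eq_constantCoeff, constantCoeff_denomD] using h

theorem mk_polyH_mul_denomD_expand (a b : ℝ) :
    PowerSeries.mk (polyH a b) + PowerSeries.mk (polyH a b) * PowerSeries.X
      + PowerSeries.mk (polyH a b) * PowerSeries.C (C a - C b * X) * PowerSeries.X ^ 2
      + PowerSeries.mk (polyH a b) * PowerSeries.C X * PowerSeries.X ^ 3 = 1 := by
  rw [← mk_polyH_mul_denomD a b, denomD]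
  simp only [map_sub, map_mul]
  ring

theorem polyH_one (a b : ℝ) : polyH a b 1 = -1 := by
  have h := congrArg (PowerSeries.coeff 1) (mk_polyH_mul_denomD_expand a b)
  simp [PowerSeries.coeff_mul_X_pow', PowerSeries.coeff_one, PowerSeries.coeff_succ_mul_X,
    polyH_zero, ← add_eq_zero_iff_eq_neg] at h ⊢
  exact h

theorem polyH_two (a b : ℝ) : polyH a b 2 = 1 - C a + C b * X := by
  have h := congrArg (PowerSeries.coeff 2) (mk_polyH_mul_denomD_expand a b)
  simp [PowerSeries.coeff_mul_X_pow', PowerSeries.coeff_one,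
    PowerSeries.coeff_succ_mul_X, polyH_zero, polyH_one] at h
  linear_combination h

theorem polyH_add_three (a b : ℝ) (m : ℕ) :
    polyH a b (m + 3) =
      -polyH a b (m + 2) - (C a - C b * X) * polyH a b (m + 1) - X * polyH a b m := by
  have h := congrArg (PowerSeries.coeff (m + 3)) (mk_polyH_mul_denomD_expand a b)
  rw [map_add, map_add, map_add, PowerSeries.coeff_succ_mul_X,
    show m + 3 = (m + 1) + 2 from rfl, PowerSeries.coeff_mul_X_pow,
    show m + 1 + 2 = m + 3 from rfl, PowerSeries.coeff_mul_X_pow, PowerSeries.coeff_mul_C,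
    PowerSeries.coeff_mul_C] at h
  simp [PowerSeries.coeff_one] at h
  linear_combination h

theorem natDegree_polyH_le (a b : ℝ) (m : ℕ) : (polyH a b m).natDegree ≤ m / 2 := by
  induction m using Nat.strong_induction_on with
  | _ m ih =>
    match m with
    | 0 => simp [polyH_zero]
    | 1 => simp [polyH_one]
    | 2 => rw [polyH_two]; compute_degree
    | m + 3 =>
      rw [polyH_add_three]
      have h2 := ih (m + 2) (by omega)
      have h1 := ih (m + 1) (by omega)
      have h0 := ih m (by omega)
      refine (natDegree_sub_le _ _).trans (max_le ((natDegree_sub_le _ _).trans (max_le ?_ ?_)) ?_)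
      · rw [natDegree_neg]; omega
      · have : (C a - C b * X : ℝ[X]).natDegree ≤ 1 := by compute_degree
        exact natDegree_mul_le.trans (by omega)
      · exact natDegree_mul_le.trans (by rw [natDegree_X]; omega)

theorem natDegree_polyH_zero_right_le (a : ℝ) (m : ℕ) : (polyH a 0 m).natDegree ≤ m / 3 := by
  induction m using Nat.strong_induction_on with
  | _ m ih =>
    match m with
    | 0 => simp [polyH_zero]
    | 1 => simp [polyH_one]
    | 2 =>
      rw [polyH_two, C_0, zero_mul, add_zero]
      exact (natDegree_sub_le _ _).trans (by simp)
    | m + 3 =>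
      rw [polyH_add_three, C_0, zero_mul, sub_zero]
      have h2 := ih (m + 2) (by omega)
      have h1 := ih (m + 1) (by omega)
      have h0 := ih m (by omega)
      refine (natDegree_sub_le _ _).trans (max_le ((natDegree_sub_le _ _).trans (max_le ?_ ?_)) ?_)
      · rw [natDegree_neg]; omega
      · exact (natDegree_C_mul_le _ _).trans (by omega)
      · exact natDegree_mul_le.trans (by rw [natDegree_X]; omega)

/-- The four-term recurrence determines the values of the polynomials `H_m` at `z` up to a common
factor; closed forms for these values are verified through this. -/
theorem mul_aeval_polyH_eq_of_recurrence {A : Type*} [CommRing A] [Algebra ℝ A] (a b : ℝ) (z c : A)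
    (f : ℕ → A) (h0 : f 0 = c) (h1 : f 1 = -c)
    (h2 : f 2 = c * (1 - algebraMap ℝ A a + algebraMap ℝ A b * z))
    (hf : ∀ m, f (m + 3) =
      -f (m + 2) - (algebraMap ℝ A a - algebraMap ℝ A b * z) * f (m + 1) - z * f m) (m : ℕ) :
    c * aeval z (polyH a b m) = f m := by
  induction m using Nat.strong_induction_on with
  | _ m ih =>
    match m with
    | 0 => simp [polyH_zero, h0]
    | 1 => simp [polyH_one, h1]
    | 2 => simp [polyH_two, h2]
    | m + 3 =>
      rw [hf, ← ih (m + 2) (by omega), ← ih (m + 1) (by omega), ← ih m (by omega),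
        polyH_add_three]
      simp only [map_sub, map_neg, map_mul, aeval_C, aeval_X]
      ring

/-! ### Closed forms at parametrized points -/

/-- If the reciprocals of the zeros of `t ↦ D(-t, z)` are `e ^ (± i φ) / r` and `η / r`, which
amounts to `r = 2 cos φ + η`, the cubic equation `hG` and `z = η / r ^ 3`, then `H_m(z)` is given by
partial fractions. When `(m + 2) φ` is a multiple of `π` the last term vanishes, and for `|η| < 1`
the term `± sin φ` decides the sign. -/
theorem aeval_polyH_trig (a b r η φ : ℝ) (hr : r = 2 * Real.cos φ + η) (hr0 : r ≠ 0)
    (hG : r * (1 + 2 * Real.cos φ * η) + b * η = a * r ^ 3) (m : ℕ) :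
    ((1 - 2 * η * Real.cos φ + η ^ 2) * Real.sin φ) * aeval (η / r ^ 3) (polyH a b m) =
      (-1 / r) ^ m * (η ^ (m + 2) * Real.sin φ + Real.sin ((m + 1) * φ)
        - η * Real.sin ((m + 2) * φ)) := by
  have step : ∀ x : ℝ, Real.sin (x + 2 * φ) = 2 * Real.cos φ * Real.sin (x + φ) - Real.sin x := by
    intro x
    have h1 := Real.sin_add (x + φ) φ
    have h2 := Real.sin_sub (x + φ) φ
    rw [show x + φ + φ = x + 2 * φ by ring] at h1
    rw [add_sub_cancel_right] at h2
    linear_combination h1 + h2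
  have s2 : Real.sin (2 * φ) = 2 * Real.cos φ * Real.sin φ := by simpa using step 0
  have s3 : Real.sin (3 * φ) = 2 * Real.cos φ * Real.sin (2 * φ) - Real.sin φ := by
    have := step φ; ring_nf at this ⊢; linarith
  have s4 : Real.sin (4 * φ) = 2 * Real.cos φ * Real.sin (3 * φ) - Real.sin (2 * φ) := by
    have := step (2 * φ); ring_nf at this ⊢; linarith
  obtain ⟨ρ, hρ⟩ : ∃ ρ, ρ = 1 / r := ⟨_, rfl⟩
  have hz : η / r ^ 3 = η * ρ ^ 3 := by rw [hρ]; field_simp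
  have hρ1 : ρ * (2 * Real.cos φ + η) = 1 := by rw [hρ, ← hr]; field_simp
  have hab : a - b * (η * ρ ^ 3) = ρ ^ 2 * (1 + 2 * Real.cos φ * η) := by
    rw [hρ]; field_simp; linear_combination -hG
  rw [hz, show -1 / r = -ρ by rw [hρ]; ring]
  refine mul_aeval_polyH_eq_of_recurrence a b _ _
    (fun m => (-ρ) ^ m * (η ^ (m + 2) * Real.sin φ + Real.sin ((m + 1) * φ)
        - η * Real.sin ((m + 2) * φ))) ?_ ?_ ?_ ?_ m
  · norm_num [s2]; ring
  · norm_num [s2, s3]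
    linear_combination (Real.sin φ * (1 - 2 * η * Real.cos φ + η ^ 2)) * hρ1
  · norm_num [s2, s3, s4]
    linear_combination (Real.sin φ * (1 - 2 * η * Real.cos φ + η ^ 2)) *
      (hab + (1 + ρ * (2 * Real.cos φ + η)) * hρ1)
  · intro k
    have e1 := step ((k + 1) * φ)
    have e2 := step ((k + 2) * φ)
    have e3 := step ((k + 3) * φ)
    rw [show (k + 1) * φ + 2 * φ = (k + 3) * φ by ring,
      show (k + 1) * φ + φ = (k + 2) * φ by ring] at e1
    rw [show (k + 2) * φ + 2 * φ = (k + 4) * φ by ring,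
      show (k + 2) * φ + φ = (k + 3) * φ by ring] at e2
    rw [show (k + 3) * φ + 2 * φ = (k + 5) * φ by ring,
      show (k + 3) * φ + φ = (k + 4) * φ by ring] at e3
    simp only [Algebra.algebraMap_self, RingHom.id_apply]
    rw [hab]
    push_cast
    rw [show (k + 3 + 1 : ℝ) = k + 4 by ring, show (k + 3 + 2 : ℝ) = k + 5 by ring,
      show (k + 2 + 1 : ℝ) = k + 3 by ring, show (k + 2 + 2 : ℝ) = k + 4 by ring,
      show (k + 1 + 1 : ℝ) = k + 2 by ring, show (k + 1 + 2 : ℝ) = k + 3 by ring,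
      e3, e2, e1]
    linear_combination (-ρ) ^ (k + 2) * (η ^ (k + 2 + 2) * Real.sin φ
      + (2 * Real.cos φ * Real.sin ((k + 2) * φ) - Real.sin ((k + 1) * φ))
      - η * (2 * Real.cos φ * (2 * Real.cos φ * Real.sin ((k + 2) * φ) - Real.sin ((k + 1) * φ))
        - Real.sin ((k + 2) * φ))) * (-hρ1)

/-- The reciprocal polynomial of `t ↦ D(-t, z)`: its roots `y` are the reciprocals of the zeros of
that denominator. The sign makes the roots have sum `1`, and `(-1) ^ m * H_m(z)` is their complete
homogeneous symmetric polynomial of degree `m`. -/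
def recipCubic (a b : ℝ) (z y : ℂ) : ℂ := y ^ 3 - y ^ 2 + (a - b * z) * y - z

theorem recipCubic_vieta {a b : ℝ} {z y₁ y₂ y₃ : ℂ} (h₁₂ : y₁ ≠ y₂) (h₁₃ : y₁ ≠ y₃)
    (h₂₃ : y₂ ≠ y₃) (h₁ : recipCubic a b z y₁ = 0) (h₂ : recipCubic a b z y₂ = 0)
    (h₃ : recipCubic a b z y₃ = 0) :
    y₁ ^ 2 + y₁ * y₂ + y₂ ^ 2 - (y₁ + y₂) + (a - b * z) = 0 ∧ y₁ + y₂ + y₃ = 1 := by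
  unfold recipCubic at *
  have d₁₂ : y₁ ^ 2 + y₁ * y₂ + y₂ ^ 2 - (y₁ + y₂) + (a - b * z) = 0 :=
    mul_left_cancel₀ (sub_ne_zero.2 h₁₂) (by linear_combination h₁ - h₂)
  have d₁₃ : y₁ ^ 2 + y₁ * y₃ + y₃ ^ 2 - (y₁ + y₃) + (a - b * z) = 0 :=
    mul_left_cancel₀ (sub_ne_zero.2 h₁₃) (by linear_combination h₁ - h₃)
  have hs : y₁ + y₂ + y₃ = 1 :=
    mul_left_cancel₀ (sub_ne_zero.2 h₂₃) (by linear_combination d₁₂ - d₁₃)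
  exact ⟨d₁₂, hs⟩

/-- Partial fractions for `H_m(z)` when the three reciprocal zeros are distinct, multiplied by their
Vandermonde determinant. -/
theorem aeval_polyH_of_roots (a b : ℝ) (z y₁ y₂ y₃ : ℂ) (h₁₂ : y₁ ≠ y₂) (h₁₃ : y₁ ≠ y₃)
    (h₂₃ : y₂ ≠ y₃) (h₁ : recipCubic a b z y₁ = 0)
    (h₂ : recipCubic a b z y₂ = 0)
    (h₃ : recipCubic a b z y₃ = 0) (m : ℕ) :
    ((y₁ - y₂) * (y₁ - y₃) * (y₂ - y₃)) * aeval z (polyH a b m) =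
      (-1) ^ m * (y₁ ^ (m + 2) * (y₂ - y₃) - y₂ ^ (m + 2) * (y₁ - y₃)
        + y₃ ^ (m + 2) * (y₁ - y₂)) := by
  obtain ⟨d₁₂, hs⟩ := recipCubic_vieta h₁₂ h₁₃ h₂₃ h₁ h₂ h₃
  unfold recipCubic at h₁ h₂ h₃
  refine mul_aeval_polyH_eq_of_recurrence a b _ _
    (fun m => (-1) ^ m * (y₁ ^ (m + 2) * (y₂ - y₃) - y₂ ^ (m + 2) * (y₁ - y₃)
        + y₃ ^ (m + 2) * (y₁ - y₂))) ?_ ?_ ?_ ?_ m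
  · ring
  · linear_combination (-(y₁ - y₂) * (y₁ - y₃) * (y₂ - y₃)) * hs
  · simp only [Complex.coe_algebraMap]
    linear_combination (y₁ - y₂) * (y₁ - y₃) * (y₂ - y₃) * (d₁₂ + (y₃ + 1) * hs)
  · intro k
    simp only [Complex.coe_algebraMap]
    linear_combination (-1) ^ (k + 3) * (y₁ ^ (k + 2) * (y₂ - y₃) * h₁
      - y₂ ^ (k + 2) * (y₁ - y₃) * h₂ + y₃ ^ (k + 2) * (y₁ - y₂) * h₃)

/-! ### Counting real zeros -/

/-- Nonreal zeros of a real polynomial come in conjugate pairs, so a single zero missing from the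
real count is real as well. -/
theorem im_eq_zero_of_card_roots {p : ℝ[X]} (hp : p ≠ 0) {S : Finset ℝ}
    (hS : ∀ x ∈ S, p.IsRoot x) (hcard : p.natDegree ≤ S.card + 1) {w : ℂ}
    (hw : aeval w p = 0) : w.im = 0 := by
  by_contra him
  obtain ⟨g, hg⟩ := p.quadratic_dvd_of_aeval_eq_zero_im_ne_zero hw him
  set q : ℝ[X] := X ^ 2 - C (2 * w.re) * X + C (‖w‖ ^ 2) with hq
  have hg0 : g ≠ 0 := by rintro rfl; simp [hg] at hp
  have hq2 : q.natDegree = 2 := by rw [hq]; compute_degree!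
  have hq0 : q ≠ 0 := by rintro h; simp [h] at hq2
  have hdeg : p.natDegree = 2 + g.natDegree := by rw [hg, natDegree_mul hq0 hg0, hq2]
  have hSg : S ⊆ g.roots.toFinset := by
    intro x hx
    have h := hS x hx
    rw [IsRoot, hg, eval_mul] at h
    have hqx : q.eval x ≠ 0 := by
      have : q.eval x = (x - w.re) ^ 2 + w.im ^ 2 := by
        have := Complex.sq_norm w
        rw [Complex.normSq_apply] at this
        simp [hq, this]; ring
      rw [this]; positivity
    simpa [hg0] using (mul_eq_zero.1 h).resolve_left hqx
  have h1 := Finset.card_le_card hSg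
  have h2 := g.roots.toFinset_card_le
  have h3 := g.card_roots'
  omega

/-! ### A branch of real parameters with a conjugate pair of dominant reciprocal zeros -/

/-- The left side of the equation linking `s = cos φ` and `η` for which some real `z`, namely
`z = η / (2 s + η) ^ 3`, gives the reciprocal zeros proportions `e ^ (i φ) : e ^ (-i φ) : η`. -/
def branchEq (a b s η : ℝ) : ℝ := (2 * s + η) * (1 + 2 * s * η) + b * η - a * (2 * s + η) ^ 3

/-- With `y = 2 s + 1 ∈ (1, 3)` the value is `y ^ 2 + b - a y ^ 3`; the worst case is `y = 3`, which
is where the condition `0 ≤ 9 - 27 a + b` comes from. -/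
theorem branchEq_one_pos {a b s : ℝ} (hb : 0 ≤ b) (h : 0 ≤ 9 - 27 * a + b) (hs0 : 0 < s)
    (hs1 : s < 1) : 0 < branchEq a b s 1 := by
  obtain ⟨y, hy⟩ : ∃ y, y = 2 * s + 1 := ⟨_, rfl⟩
  have e : branchEq a b s 1 = y ^ 2 + b - a * y ^ 3 := by rw [branchEq, hy]; ring
  have hy1 : 1 < y := by linarith
  have hy3 : y < 3 := by linarith
  have h1 : 27 * a * y ^ 3 ≤ (9 + b) * y ^ 3 := by
    apply mul_le_mul_of_nonneg_right (by linarith); positivity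
  have h2 : y ^ 3 ≤ 27 := by
    have := pow_le_pow_left₀ (by linarith) hy3.le 3
    linarith
  have h3 : 0 < y ^ 2 * (3 - y) := by apply mul_pos <;> [positivity; linarith]
  have h4 := mul_le_mul_of_nonneg_left h2 hb
  rw [e]; linarith

/-- For `s > 1 / 2` and `y = 2 s - 1 ∈ (0, 1)` the value is `-(y ^ 2 + b + a y ^ 3)`; the worst case
is `y = 1`, which is where the condition `0 ≤ 1 + a + b` comes from. For `s ≤ 1 / 2` the left end
`η = -2 s` is the one where `r = 2 s + η` vanishes. -/
theorem branchEq_left_neg {a b s : ℝ} (hb : 0 ≤ b) (h : 0 ≤ 1 + a + b) (hs0 : 0 < s) (hs1 : s < 1)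
    (hbs : 0 < b ∨ 1 / 2 < s) : branchEq a b s (max (-1) (-(2 * s))) < 0 := by
  rcases lt_or_ge (1 / 2) s with hs | hs
  · rw [max_eq_left (by linarith)]
    obtain ⟨y, hy⟩ : ∃ y, y = 2 * s - 1 := ⟨_, rfl⟩
    have e : branchEq a b s (-1) = -(y ^ 2 + b + a * y ^ 3) := by rw [branchEq, hy]; ring
    have hy0 : 0 < y := by linarith
    have hy1 : y < 1 := by linarith
    have h1 : 0 ≤ (1 + a + b) * y ^ 3 := by positivity
    have h2 : y ^ 3 ≤ 1 := pow_le_one₀ hy0.le hy1.le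
    have h3 : 0 < y ^ 2 * (1 - y) := by apply mul_pos <;> [positivity; linarith]
    have h4 := mul_le_mul_of_nonneg_left h2 hb
    rw [e]; linarith
  · have hb0 : 0 < b := hbs.resolve_right (by linarith)
    rw [max_eq_right (by linarith)]
    have : 0 < b * s := mul_pos hb0 hs0
    rw [branchEq]; ring_nf; linarith

/-- As a polynomial in `r = 2 s + η`, `branchEq` is a cubic with leading coefficient `-a`. If it had
two roots in the range, its constant term `-2 b s`, its coefficient `2 s` of `r ^ 2` and its positive
value at `η = 1` would impose contradictory signs on the third factor. -/
theorem branchEq_root_unique {a b s η₁ η₂ : ℝ} (hb : 0 ≤ b) (hs : 0 < s)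
    (hpos : 0 < branchEq a b s 1) (h₁ : branchEq a b s η₁ = 0) (h₂ : branchEq a b s η₂ = 0)
    (h₁1 : η₁ < 1) (h₂1 : η₂ < 1) (h₁0 : 0 < 2 * s + η₁) (h₂0 : 0 < 2 * s + η₂) : η₁ = η₂ := by
  by_contra hne
  obtain ⟨x, hx⟩ : ∃ x, x = 2 * s + η₁ := ⟨_, rfl⟩
  obtain ⟨y, hy⟩ : ∃ y, y = 2 * s + η₂ := ⟨_, rfl⟩
  have hxy : x - y ≠ 0 := by rw [hx, hy]; intro h; apply hne; linarith
  obtain rfl : η₁ = x - 2 * s := by linarith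
  obtain rfl : η₂ = y - 2 * s := by linarith
  rw [← hx] at h₁0
  rw [← hy] at h₂0
  unfold branchEq at *
  -- the cubic in `r = 2 s + η` is `(r - x) * (r - y) * (e - a * r)`
  obtain ⟨e, he⟩ : ∃ e, e = 2 * s + a * -(x + y) := ⟨_, rfl⟩
  have hd : (1 - 4 * s ^ 2 + b) + 2 * s * (x + y) - a * (x ^ 2 + x * y + y ^ 2) = 0 :=
    mul_left_cancel₀ hxy (by linear_combination h₁ - h₂)
  have he0 : x * y * e = -(2 * b * s) := by
    rw [he]; linear_combination x * hd - h₁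
  have hxy0 : 0 < x * y := mul_pos h₁0 h₂0
  have hle : e ≤ 0 := by
    by_contra hlt
    have := mul_pos hxy0 (not_le.1 hlt)
    have : 0 ≤ b * s := by positivity
    linarith
  have hfac : 0 < (2 * s + 1 - x) * (2 * s + 1 - y) * (e - a * (2 * s + 1)) := by
    refine hpos.trans_eq ?_
    rw [he]
    linear_combination h₁ + (2 * s + 1 - x) * hd
  have h3 : 0 < e - a * (2 * s + 1) := by
    refine pos_of_mul_pos_right hfac ?_
    apply mul_nonneg <;> linarith
  have ha : a < 0 := by nlinarith
  have h4 : a * (x + y) < 0 := mul_neg_of_neg_of_pos ha (by linarith)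
  linarith

theorem continuous_branchEq (a b : ℝ) : Continuous fun p : ℝ × ℝ => branchEq a b p.1 p.2 := by
  unfold branchEq; fun_prop

/-- Since `branchEq a b s` changes sign exactly once, its zero depends continuously on `s`. The lower
bound `c` is `0`, or `1 / 2` when `b = 0`. -/
theorem exists_continuousOn_branch {a b c : ℝ} (hb : 0 ≤ b) (h₁ : 0 ≤ 1 + a + b)
    (h₂ : 0 ≤ 9 - 27 * a + b) (hc : 0 ≤ c) (hbc : 0 < b ∨ 1 / 2 ≤ c) :
    ∃ f : ℝ → ℝ, ContinuousOn f (Set.Ioo c 1) ∧ ∀ s ∈ Set.Ioo c 1,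
      -1 < f s ∧ f s < 1 ∧ 0 < 2 * s + f s ∧ branchEq a b s (f s) = 0 := by
  have hcont : ∀ s, Continuous (branchEq a b s) := fun s =>
    (continuous_branchEq a b).comp (by fun_prop : Continuous fun η : ℝ => (s, η))
  have hcont' : ∀ η, Continuous (fun s => branchEq a b s η) := fun η =>
    (continuous_branchEq a b).comp (by fun_prop : Continuous fun s : ℝ => (s, η))
  have hpos : ∀ s ∈ Set.Ioo c 1, 0 < branchEq a b s 1 := fun s hs =>
    branchEq_one_pos hb h₂ (hc.trans_lt hs.1) hs.2
  have hneg : ∀ s ∈ Set.Ioo c 1, branchEq a b s (max (-1) (-(2 * s))) < 0 := fun s hs =>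
    branchEq_left_neg hb h₁ (hc.trans_lt hs.1) hs.2 (hbc.imp_right fun h => h.trans_lt hs.1)
  have hex : ∀ s ∈ Set.Ioo c 1, ∃ η, max (-1) (-(2 * s)) < η ∧ η < 1 ∧ branchEq a b s η = 0 := by
    intro s hs
    have hs0 := hc.trans_lt hs.1
    obtain ⟨η, hη, h⟩ := intermediate_value_Ioo
      (max_le (by norm_num) (by linarith) : max (-1) (-(2 * s)) ≤ 1) (hcont s).continuousOn
      ⟨hneg s hs, hpos s hs⟩
    exact ⟨η, hη.1, hη.2, h⟩
  choose! f hfl hf1 hf using hex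
  have huniq : ∀ s ∈ Set.Ioo c 1, ∀ η, max (-1) (-(2 * s)) < η → η < 1 → branchEq a b s η = 0 →
      η = f s := by
    intro s hs η hl h1 h
    have hl' := (le_max_right (-1) (-(2 * s))).trans_lt hl
    have hf' := (le_max_right (-1) (-(2 * s))).trans_lt (hfl s hs)
    exact branchEq_root_unique hb (hc.trans_lt hs.1) (hpos s hs) h (hf s hs) h1 (hf1 s hs)
      (by linarith) (by linarith)
  have hright : ∀ s ∈ Set.Ioo c 1, ∀ η, f s < η → η < 1 → 0 < branchEq a b s η := by
    intro s hs η hη h1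
    by_contra! hle
    obtain ⟨x, hx, h⟩ := intermediate_value_Ico h1.le (hcont s).continuousOn ⟨hle, hpos s hs⟩
    have := huniq s hs x ((hfl s hs).trans (hη.trans_le hx.1)) hx.2 h
    linarith [hx.1]
  have hleft : ∀ s ∈ Set.Ioo c 1, ∀ η, max (-1) (-(2 * s)) < η → η < f s →
      branchEq a b s η < 0 := by
    intro s hs η hη h1
    by_contra! hle
    obtain ⟨x, hx, h⟩ := intermediate_value_Ioc hη.le (hcont s).continuousOn ⟨hneg s hs, hle⟩
    have := huniq s hs x hx.1 (hx.2.trans_lt (h1.trans (hf1 s hs))) h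
    linarith [hx.2]
  refine ⟨f, fun s hs => ?_, fun s hs => ⟨(le_max_left _ _).trans_lt (hfl s hs), hf1 s hs, ?_,
    hf s hs⟩⟩
  · have hlc : Continuous fun s : ℝ => max (-1) (-(2 * s)) := by fun_prop
    have hD : ∀ᶠ t in nhds s, t ∈ Set.Ioo c 1 := isOpen_Ioo.mem_nhds hs
    refine ContinuousAt.continuousWithinAt (tendsto_order.2 ⟨fun x hx => ?_, fun x hx => ?_⟩)
    · obtain ⟨y, hy, hyf⟩ := exists_between (max_lt hx (hfl s hs))
      rw [max_lt_iff] at hy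
      filter_upwards [hD, (hcont' y).continuousAt.eventually_lt continuousAt_const
        (hleft s hs y hy.2 hyf)] with t ht hneg
      by_contra! hle
      exact absurd (hright t ht y (hle.trans_lt hy.1) (hyf.trans (hf1 s hs))) (not_lt.2 hneg.le)
    · obtain ⟨y, hyf, hy⟩ := exists_between (lt_min hx (hf1 s hs))
      rw [lt_min_iff] at hy
      filter_upwards [hD, continuousAt_const.eventually_lt (hcont' y).continuousAt
        (hright s hs y hyf hy.2), hlc.continuousAt.eventually_lt continuousAt_const
        ((hfl s hs).trans hyf)] with t ht hpos hl
      by_contra! hle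
      exact absurd (hleft t ht y hl (hy.1.trans_le hle)) (not_lt.2 hpos.le)
  · linarith [(le_max_right (-1) (-(2 * s))).trans_lt (hfl s hs)]

/-- The real number `z` determines the cubic, hence its nonreal roots, hence their argument. -/
theorem branch_param_injective {a b s t η θ : ℝ} (ht0 : 0 < t) (ht1 : t < 1)
    (hη : 0 < 2 * s + η) (hθ : 0 < 2 * t + θ) (h : branchEq a b s η = 0)
    (h' : branchEq a b t θ = 0) (heq : η / (2 * s + η) ^ 3 = θ / (2 * t + θ) ^ 3) : s = t := by
  obtain ⟨ρ, hρ⟩ : ∃ ρ, ρ = (2 * s + η)⁻¹ := ⟨_, rfl⟩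
  obtain ⟨σ, hσ⟩ : ∃ σ, σ = (2 * t + θ)⁻¹ := ⟨_, rfl⟩
  have hρ0 : 0 < ρ := by rw [hρ]; positivity
  have hσ0 : 0 < σ := by rw [hσ]; positivity
  have hρ1 : ρ * (2 * s + η) = 1 := by rw [hρ]; exact inv_mul_cancel₀ hη.ne'
  have hσ1 : σ * (2 * t + θ) = 1 := by rw [hσ]; exact inv_mul_cancel₀ hθ.ne'
  rw [div_eq_mul_inv, div_eq_mul_inv, ← inv_pow, ← inv_pow, ← hρ, ← hσ] at heq
  have k : ρ ^ 2 * (1 + 2 * s * η) = a - b * (η * ρ ^ 3) := by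
    unfold branchEq at h
    rw [hρ]; field_simp; linear_combination h
  have k' : σ ^ 2 * (1 + 2 * t * θ) = a - b * (θ * σ ^ 3) := by
    unfold branchEq at h'
    rw [hσ]; field_simp; linear_combination h'
  -- `x = η ρ` and `y = θ σ` are real roots of the same cubic
  -- the quadratic factor belongs to the nonreal pair for `t` and has no real zero
  have hroot : (η * ρ - θ * σ) * ((η * ρ) ^ 2 - 2 * t * σ * (η * ρ) + σ ^ 2) = 0 := by
    linear_combination (η * ρ) ^ 2 * (hρ1 - hσ1) + η * ρ * (k' - k) + (b * (η * ρ) + 1) * heq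
  have hquad : 0 < (η * ρ) ^ 2 - 2 * t * σ * (η * ρ) + σ ^ 2 := by
    have : 0 < σ ^ 2 * (1 - t ^ 2) := mul_pos (by positivity) (by nlinarith)
    nlinarith [sq_nonneg (η * ρ - t * σ)]
  have hxy : η * ρ = θ * σ := by
    linarith [(mul_eq_zero.1 hroot).resolve_right hquad.ne']
  have hst : s * ρ = t * σ := by linarith
  have hsq : ρ ^ 2 = σ ^ 2 := by
    linear_combination k - k' - b * heq - 2 * s * ρ * hxy - 2 * θ * σ * hst
  have hρσ : ρ = σ := by
    rwa [pow_left_inj₀ hρ0.le hσ0.le two_ne_zero] at hsq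
  rw [hρσ] at hst
  exact mul_right_cancel₀ hσ0.ne' hst

/-! ### Sufficiency of the conditions -/

/-- At the nodes `φ = i π / (m + 2)`, `1 ≤ i ≤ m / K`, the values of `H_m` along the branch alternate
in sign, which gives `m / K - 1` distinct real zeros, one fewer than the bound on the degree. Here
`K` is `2`, or `3` when `b = 0`. -/
theorem im_eq_zero_of_branch {a b : ℝ} {K m : ℕ} (hK : 2 ≤ K) {f : ℝ → ℝ}
    (hf : ContinuousOn f (Set.Ioo (Real.cos (Real.pi / K)) 1))
    (hfs : ∀ s ∈ Set.Ioo (Real.cos (Real.pi / K)) 1,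
      -1 < f s ∧ f s < 1 ∧ 0 < 2 * s + f s ∧ branchEq a b s (f s) = 0)
    (hdeg : (polyH a b m).natDegree ≤ m / K) (hm : K < m + 2) {w : ℂ}
    (hw : aeval w (polyH a b m) = 0) : w.im = 0 := by
  have hpi := Real.pi_pos
  have hK0 : (0 : ℝ) < K := by positivity
  have hmK : K * (m / K) ≤ m := Nat.mul_div_le m K
  have hle : Real.pi / K ≤ Real.pi := div_le_self hpi.le (by norm_cast; omega)
  have hcos : ∀ φ ∈ Set.Ioo 0 (Real.pi / K), Real.cos φ ∈ Set.Ioo (Real.cos (Real.pi / K)) 1 := by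
    intro φ hφ
    constructor
    · exact Real.cos_lt_cos_of_nonneg_of_le_pi hφ.1.le hle hφ.2
    · rw [← Real.cos_zero]
      exact Real.cos_lt_cos_of_nonneg_of_le_pi le_rfl (hφ.2.le.trans hle) hφ.1
  have hcos0 : ∀ φ ∈ Set.Ioo 0 (Real.pi / K), 0 < Real.cos φ := by
    intro φ hφ
    have : Real.pi / K ≤ Real.pi / 2 :=
      div_le_div_of_nonneg_left hpi.le two_pos (by exact_mod_cast hK)
    exact Real.cos_pos_of_mem_Ioo ⟨by linarith [hφ.1], hφ.2.trans_le this⟩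
  set z : ℝ → ℝ := fun φ => f (Real.cos φ) / (2 * Real.cos φ + f (Real.cos φ)) ^ 3 with hz
  have hzc : ContinuousOn z (Set.Ioo 0 (Real.pi / K)) := by
    have hfc : ContinuousOn (fun φ => f (Real.cos φ)) (Set.Ioo 0 (Real.pi / K)) :=
      hf.comp Real.continuous_cos.continuousOn hcos
    refine hfc.div (((continuousOn_const.mul Real.continuous_cos.continuousOn).add hfc).pow 3) ?_
    intro φ hφ
    exact (pow_pos (hfs _ (hcos φ hφ)).2.2.1 3).ne'
  have hzinj : Set.InjOn z (Set.Ioo 0 (Real.pi / K)) := by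
    intro φ hφ ψ hψ h
    obtain ⟨-, -, h1, h2⟩ := hfs _ (hcos φ hφ)
    obtain ⟨-, -, h1', h2'⟩ := hfs _ (hcos ψ hψ)
    have := branch_param_injective (hcos0 ψ hψ) (hcos ψ hψ).2 h1 h1' h2 h2' h
    exact Real.injOn_cos ⟨hφ.1.le, hφ.2.le.trans hle⟩ ⟨hψ.1.le, hψ.2.le.trans hle⟩ this
  set node : ℕ → ℝ := fun i => i * Real.pi / (m + 2) with hnode
  have hnode_mem : ∀ i, 1 ≤ i → K * i < m + 2 → node i ∈ Set.Ioo 0 (Real.pi / K) := by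
    intro i hi hiK
    have hi0 : (0 : ℝ) < i := by exact_mod_cast hi
    have hiK' : (K * i : ℝ) < m + 2 := by exact_mod_cast hiK
    refine ⟨by positivity, ?_⟩
    rw [hnode, div_lt_div_iff₀ (by positivity) hK0]
    linarith [mul_lt_mul_of_pos_right hiK' hpi]
  have hsign : ∀ i, 1 ≤ i → K * i < m + 2 →
      0 < (-1) ^ (m + i + 1) * (polyH a b m).eval (z (node i)) := by
    intro i hi hiK
    have hmem := hnode_mem i hi hiK
    set φ := node i with hφ
    set s := Real.cos φ with hs
    set η := f s with hη
    obtain ⟨hη0, hη1, hr, hG⟩ := hfs s (hcos φ hmem)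
    have hsin : 0 < Real.sin φ := Real.sin_pos_of_pos_of_lt_pi hmem.1 (hmem.2.trans_le hle)
    have key := aeval_polyH_trig a b (2 * s + η) η φ rfl hr.ne'
      (by unfold branchEq at hG; linear_combination hG) m
    have hmφ : (m + 2 : ℝ) * φ = i * Real.pi := by rw [hφ, hnode]; field_simp
    have h2 : Real.sin ((m + 2) * φ) = 0 := by rw [hmφ]; exact Real.sin_nat_mul_pi i
    have h1 : Real.sin ((m + 1) * φ) = (-1) ^ (i + 1) * Real.sin φ := by
      rw [show (m + 1) * φ = i * Real.pi - φ by rw [← hmφ]; ring, Real.sin_nat_mul_pi_sub,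
        pow_succ]
      ring
    rw [h1, h2, mul_zero, sub_zero, coe_aeval_eq_eval, ← hs] at key
    have hd : 0 < (1 - 2 * η * s + η ^ 2) * Real.sin φ := by
      apply mul_pos _ hsin
      have hs1 := (hcos φ hmem).2
      have hs0 := hcos0 φ hmem
      have : 0 < 1 - s ^ 2 := by rw [← hs] at hs1 hs0; nlinarith
      nlinarith [sq_nonneg (η - s)]
    have hηm : |η ^ (m + 2)| < 1 := by
      rw [abs_pow]
      exact pow_lt_one₀ (abs_nonneg _) (abs_lt.2 ⟨hη0, hη1⟩) (by omega)
    have hnum : 0 < (-1) ^ (i + 1) * η ^ (m + 2) + 1 := by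
      have : |(-1) ^ (i + 1) * η ^ (m + 2)| < 1 := by
        rwa [abs_mul, abs_pow, abs_neg, abs_one, one_pow, one_mul]
      linarith [(abs_lt.1 this).1]
    have hsq : ∀ n : ℕ, ((-1 : ℝ) ^ n) ^ 2 = 1 := fun n => by
      rw [← pow_mul, mul_comm, pow_mul]; norm_num
    refine pos_of_mul_pos_right (a := (1 - 2 * η * s + η ^ 2) * Real.sin φ) ?_ hd.le
    have : (1 - 2 * η * s + η ^ 2) * Real.sin φ *
        ((-1) ^ (m + i + 1) * (polyH a b m).eval (η / (2 * s + η) ^ 3)) =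
        (1 / (2 * s + η)) ^ m * Real.sin φ * ((-1) ^ (i + 1) * η ^ (m + 2) + 1) := by
      have e : (-1 / (2 * s + η)) ^ m = (-1) ^ m * (1 / (2 * s + η)) ^ m := by
        rw [← mul_pow]; congr 1; ring
      rw [e] at key
      have hm := hsq m
      have hi := hsq (i + 1)
      rw [show m + i + 1 = m + (i + 1) by ring, pow_add]
      generalize (-1 : ℝ) ^ m = u at *
      generalize (-1 : ℝ) ^ (i + 1) = v at *
      linear_combination u * v * key + (1 / (2 * s + η)) ^ m * Real.sin φ *
        (v * (η ^ (m + 2) + v) * hm + hi)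
    rw [this]
    positivity
  have hne : polyH a b m ≠ 0 := by
    intro h
    simpa [h] using hsign 1 le_rfl (by omega)
  have hzero : ∀ i ∈ Finset.Ico 1 (m / K), ∃ φ, node i < φ ∧ φ < node (i + 1) ∧
      (polyH a b m).eval (z φ) = 0 := by
    intro i hi
    rw [Finset.mem_Ico] at hi
    have hi1 : K * (i + 1) < m + 2 :=
      ((Nat.mul_le_mul_left K (Nat.succ_le_of_lt hi.2)).trans hmK).trans_lt (by omega)
    have hi0 : K * i < m + 2 := (Nat.mul_le_mul_left K i.le_succ).trans_lt hi1
    have hlt : node i < node (i + 1) := by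
      rw [hnode]
      push_cast
      apply div_lt_div_of_pos_right _ (by positivity)
      linarith
    have hsub : Set.Icc (node i) (node (i + 1)) ⊆ Set.Ioo 0 (Real.pi / K) :=
      Set.Icc_subset _ (hnode_mem i hi.1 hi0) (hnode_mem (i + 1) (by omega) hi1)
    have hcont : ContinuousOn (fun φ => (-1) ^ (m + i + 1) * (polyH a b m).eval (z φ))
        (Set.Icc (node i) (node (i + 1))) :=
      continuousOn_const.mul ((polyH a b m).continuous.comp_continuousOn (hzc.mono hsub))
    have h1 := hsign i hi.1 hi0
    have h2 := hsign (i + 1) (by omega) hi1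
    rw [show m + (i + 1) + 1 = (m + i + 1) + 1 by ring, pow_succ] at h2
    obtain ⟨φ, hφ, h⟩ := intermediate_value_Ioo' hlt.le hcont ⟨by linarith, h1⟩
    exact ⟨φ, hφ.1, hφ.2, by simpa using h⟩
  choose! c hc1 hc2 hc using hzero
  have hnode_mono : Monotone node := by
    intro i j hij
    rw [hnode]
    have : (i : ℝ) ≤ j := by exact_mod_cast hij
    dsimp only
    gcongr
  have hcmem : ∀ i ∈ Finset.Ico 1 (m / K), c i ∈ Set.Ioo 0 (Real.pi / K) := by
    intro i hi
    have hi' := Finset.mem_Ico.1 hi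
    have hi1 : K * (i + 1) < m + 2 :=
      ((Nat.mul_le_mul_left K (Nat.succ_le_of_lt hi'.2)).trans hmK).trans_lt (by omega)
    have hi0 : K * i < m + 2 := (Nat.mul_le_mul_left K i.le_succ).trans_lt hi1
    exact ⟨(hnode_mem i hi'.1 hi0).1.trans (hc1 i hi),
      (hc2 i hi).trans (hnode_mem (i + 1) (by omega) hi1).2⟩
  have hcmono : StrictMonoOn c (Finset.Ico 1 (m / K)) := by
    intro i hi j hj hij
    exact (hc2 i hi).trans_le ((hnode_mono hij).trans (hc1 j hj).le)
  have hinj : Set.InjOn (fun i => z (c i)) (Finset.Ico 1 (m / K)) :=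
    hzinj.comp hcmono.injOn hcmem
  refine im_eq_zero_of_card_roots hne (S := (Finset.Ico 1 (m / K)).image fun i => z (c i)) ?_ ?_ hw
  · intro x hx
    obtain ⟨i, hi, rfl⟩ := Finset.mem_image.1 hx
    exact hc i hi
  · rw [Finset.card_image_of_injOn hinj, Nat.card_Ico]
    omega

theorem im_eq_zero_of_aeval_polyH {a b : ℝ} (hb : 0 ≤ b) (h₁ : 0 ≤ 1 + a + b)
    (h₂ : 0 ≤ 9 - 27 * a + b) (m : ℕ) {w : ℂ} (hw : aeval w (polyH a b m) = 0) : w.im = 0 := by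
  rcases Nat.lt_or_ge 1 m with hm | hm
  · rcases hb.eq_or_lt with rfl | hb0
    · have hc : Real.cos (Real.pi / (3 : ℕ)) = 1 / 2 := by norm_num
      obtain ⟨f, hf, hfs⟩ := exists_continuousOn_branch (c := 1 / 2) le_rfl h₁ h₂ (by norm_num)
        (Or.inr le_rfl)
      rw [← congrArg (Set.Ioo · 1) hc] at hf hfs
      exact im_eq_zero_of_branch (by norm_num) hf hfs (natDegree_polyH_zero_right_le a m)
        (by omega) hw
    · have hc : Real.cos (Real.pi / (2 : ℕ)) = 0 := by norm_num
      obtain ⟨f, hf, hfs⟩ := exists_continuousOn_branch hb h₁ h₂ le_rfl (Or.inl hb0)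
      rw [← congrArg (Set.Ioo · 1) hc] at hf hfs
      exact im_eq_zero_of_branch le_rfl hf hfs (natDegree_polyH_le a b m) (by omega) hw
  · interval_cases m
    · simp [polyH_zero] at hw
    · simp [polyH_one] at hw

open Filter Topology ComplexConjugate

/-! ### Real zeros and the growth off the real axis -/

/-- A polynomial with only real zeros is smallest, on each vertical line, on the real axis. -/
theorem norm_aeval_re_le {p : ℝ[X]} (h : ∀ z : ℂ, aeval z p = 0 → z.im = 0) (w : ℂ) :
    ‖aeval (w.re : ℂ) p‖ ≤ ‖aeval w p‖ := by
  have key : ∀ z : ℂ, ‖aeval z p‖ = ‖(p.map (algebraMap ℝ ℂ)).leadingCoeff‖ *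
      ((p.map (algebraMap ℝ ℂ)).roots.map fun x => ‖z - x‖).prod := by
    intro z
    rw [← eval_map_algebraMap, (IsAlgClosed.splits _).eval_eq_prod_roots, norm_mul]
    congr 1
    exact (Multiset.prod_hom' _ (normHom : ℂ →*₀ ℝ) _).symm
  rw [key, key]
  refine mul_le_mul_of_nonneg_left (Multiset.prod_map_le_prod_map₀ _ _
    (fun _ _ => norm_nonneg _) fun x hx => ?_) (norm_nonneg _)
  have hx0 : x.im = 0 := h x (by
    rw [← eval_map_algebraMap]; exact (mem_roots'.1 hx).2)
  have : (w.re : ℂ) - x = ((w - x).re : ℂ) := by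
    apply Complex.ext <;> simp [hx0]
  rw [this, Complex.norm_real]
  exact Complex.abs_re_le_norm _

/-! ### Perturbation of the reciprocal zeros -/

/-- A monic polynomial that is small at `x` has a root close to `x`. -/
theorem exists_root_norm_sub_pow_le {p : ℂ[X]} (hp : p.Monic) (hd : p.natDegree ≠ 0) (x : ℂ) :
    ∃ ξ, p.eval ξ = 0 ∧ ‖x - ξ‖ ^ p.natDegree ≤ ‖p.eval x‖ := by
  by_contra! hcon
  have hs : p.Splits := IsAlgClosed.splits p
  have hcard := hs.natDegree_eq_card_roots
  have e : ‖p.eval x‖ = (p.roots.map fun ξ => ‖x - ξ‖).prod := by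
    rw [hs.eval_eq_prod_roots_of_monic hp]
    exact (Multiset.prod_hom' _ (normHom : ℂ →*₀ ℝ) _).symm
  obtain ⟨ξ, hξ, hmin⟩ := (p.roots.toFinset).exists_min_image (fun ξ => ‖x - ξ‖) (by
    rw [Multiset.toFinset_nonempty]
    rintro h
    rw [h, Multiset.card_zero] at hcard
    exact hd hcard)
  have hξ' := Multiset.mem_toFinset.1 hξ
  refine absurd (hcon ξ (mem_roots'.1 hξ').2) (not_lt.2 ?_)
  rw [e, hcard, ← Multiset.prod_replicate, ← Multiset.map_const']
  exact Multiset.prod_map_le_prod_map₀ _ _ (fun _ _ => norm_nonneg _)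
    fun ζ hζ => hmin ζ (Multiset.mem_toFinset.2 hζ)

theorem exists_recipCubic_root_near (a b : ℝ) (z y : ℂ) :
    ∃ ξ, recipCubic a b z ξ = 0 ∧ ‖y - ξ‖ ^ 3 ≤ ‖recipCubic a b z y‖ := by
  have hm : (X ^ 3 - X ^ 2 + C (a - b * z) * X - C z : ℂ[X]).Monic := by monicity!
  have hd : (X ^ 3 - X ^ 2 + C (a - b * z) * X - C z : ℂ[X]).natDegree = 3 := by compute_degree!
  obtain ⟨ξ, h1, h2⟩ := exists_root_norm_sub_pow_le hm (by rw [hd]; norm_num) y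
  rw [hd] at h2
  exact ⟨ξ, by simpa [recipCubic] using h1, by simpa [recipCubic] using h2⟩

/-- A simple root `y` at `z` extends to roots `ξ m` at `z + u / m`, and `(ξ m / y) ^ m` converges to
the exponential of `u` times the logarithmic derivative of the root with respect to `z`. -/
theorem exists_tendsto_recipCubic_root (a b : ℝ) (z y u : ℂ) (hy : recipCubic a b z y = 0)
    (hy0 : y ≠ 0) (hF : 3 * y ^ 2 - 2 * y + (a - b * z) ≠ 0) :
    ∃ ξ : ℕ → ℂ, (∀ m : ℕ, recipCubic a b (z + u / m) (ξ m) = 0) ∧ Tendsto ξ atTop (𝓝 y) ∧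
      Tendsto (fun m : ℕ => (ξ m / y) ^ m) atTop
        (𝓝 (Complex.exp ((b * y + 1) / (y * (3 * y ^ 2 - 2 * y + (a - b * z))) * u))) := by
  choose ξ hξ hle using fun m : ℕ => exists_recipCubic_root_near a b (z + u / m) y
  have hzt : Tendsto (fun m : ℕ => u / m) atTop (𝓝 0) :=
    by simpa [div_eq_mul_inv] using (tendsto_inv_atTop_nhds_zero_nat (𝕜 := ℂ)).const_mul u
  have hval : ∀ m : ℕ, recipCubic a b (z + u / m) y = -(b * y + 1) * (u / m) := by
    intro m
    unfold recipCubic at hy ⊢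
    linear_combination hy
  have hlim : Tendsto ξ atTop (𝓝 y) := by
    have h3 : Tendsto (fun m => ‖y - ξ m‖ ^ 3) atTop (𝓝 0) := by
      refine squeeze_zero (fun m => by positivity) hle ?_
      simp_rw [hval]
      simpa using (hzt.const_mul (-(b * y + 1))).norm
    have h1 : Tendsto (fun m => ‖y - ξ m‖) atTop (𝓝 0) := by
      have := (h3.rpow_const (p := 1 / 3) (Or.inr (by norm_num)))
      rw [Real.zero_rpow (by norm_num)] at this
      refine this.congr fun m => ?_
      rw [← Real.rpow_natCast, ← Real.rpow_mul (norm_nonneg _)]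
      norm_num
    rw [tendsto_iff_norm_sub_tendsto_zero]
    simpa only [norm_sub_rev] using h1
  refine ⟨ξ, hξ, hlim, ?_⟩
  set F := 3 * y ^ 2 - 2 * y + (a - b * z) with hFdef
  -- the divided difference of the cubic between `y` and `ξ m`
  set Q : ℕ → ℂ := fun m =>
    ξ m ^ 2 + ξ m * y + y ^ 2 - (ξ m + y) + (a - b * (z + u / m)) with hQ
  have hQlim : Tendsto Q atTop (𝓝 F) := by
    have := ((((hlim.pow 2).add (hlim.mul_const y)).add_const (y ^ 2)).sub
      (hlim.add_const y)).add (((hzt.const_add z).const_mul (b : ℂ)).const_sub (a : ℂ))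
    refine this.trans_eq ?_
    congr 1
    rw [hFdef]; ring
  have hdiff : ∀ m, (ξ m - y) * Q m = (b * y + 1) * (u / m) := by
    intro m
    have h1 := hξ m
    have h2 := hval m
    unfold recipCubic at h1 h2
    rw [hQ]
    linear_combination h1 - h2
  have hg : Tendsto (fun m : ℕ => (m : ℂ) * (ξ m / y - 1)) atTop
      (𝓝 ((b * y + 1) / (y * F) * u)) := by
    have hlim' : Tendsto (fun m => (b * y + 1) * u / (y * Q m)) atTop
        (𝓝 ((b * y + 1) * u / (y * F))) :=
      tendsto_const_nhds.div (hQlim.const_mul y) (mul_ne_zero hy0 hF)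
    rw [div_mul_eq_mul_div]
    refine hlim'.congr' ?_
    filter_upwards [hQlim.eventually_ne hF, eventually_ne_atTop 0] with m hm hm0
    have hm0' : (m : ℂ) ≠ 0 := Nat.cast_ne_zero.2 hm0
    have h := hdiff m
    field_simp at h ⊢
    linear_combination -h
  simpa using Complex.tendsto_one_add_pow_exp_of_tendsto hg

/-- The exponential sum `1 + v * exp (β u) + v' * exp (conj β u)` does not satisfy the inequality that
limits of polynomials with only real zeros inherit: far to the right it is close to `1` on the real
axis, but close to `1 / 2` at suitable points off it. -/
theorem exists_exp_sum_norm_lt {v v' β : ℂ} (hv : v ≠ 0) (hre : β.re < 0) (him : β.im ≠ 0) :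
    ∃ u : ℂ, ‖1 + v * Complex.exp (β * u) + v' * Complex.exp (conj β * u)‖ <
      ‖1 + v * Complex.exp (β * u.re) + v' * Complex.exp (conj β * u.re)‖ := by
  -- the sign of `β.im`, as an integer
  obtain ⟨ε, hε⟩ : ∃ ε : ℤ, (ε : ℝ) * β.im = |β.im| := by
    rcases abs_choice β.im with h | h
    · exact ⟨1, by rw [h]; simp⟩
    · exact ⟨-1, by rw [h]; simp⟩
  have hβ : β ≠ 0 := by rintro rfl; simp at him
  have hn : 0 < Complex.normSq β := Complex.normSq_pos.2 hβ
  obtain ⟨c, hc⟩ : ∃ c, c = Complex.log (-1 / (2 * v)) := ⟨_, rfl⟩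
  have hec : v * Complex.exp c = -1 / 2 := by
    rw [hc, Complex.exp_log (by simp [hv])]; field_simp
  -- along the solutions `u` of `v * exp (β * u) = -1 / 2`, the real part is unbounded above
  set U : ℕ → ℂ := fun n => (c + (ε * n : ℤ) * (2 * Real.pi * Complex.I)) / β with hU
  have hUv : ∀ n, v * Complex.exp (β * U n) = -1 / 2 := by
    intro n
    rw [hU, mul_div_cancel₀ _ hβ, (Complex.exp_periodic.int_mul (ε * n)) c, hec]
  have hre' : ∀ n, (β * U n).re = c.re := by
    intro n
    rw [hU, mul_div_cancel₀ _ hβ]; simp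
  have hUre : ∀ n, (U n).re = (c.re * β.re + c.im * β.im) / Complex.normSq β +
      n * (2 * Real.pi * |β.im| / Complex.normSq β) := by
    intro n
    rw [hU, ← hε]
    simp [Complex.div_re]
    ring
  have htop : Tendsto (fun n => (U n).re) atTop atTop := by
    simp_rw [hUre]
    refine tendsto_atTop_add_const_left _ _ (tendsto_natCast_atTop_atTop.atTop_mul_const ?_)
    have := abs_pos.2 him
    positivity
  have hexp : Tendsto (fun x : ℝ => Real.exp (β.re * x)) atTop (𝓝 0) :=
    Real.tendsto_exp_atBot.comp (tendsto_id.const_mul_atTop_of_neg hre)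
  have h1 : Tendsto (fun x : ℝ => (‖v‖ + ‖v'‖) * Real.exp (β.re * x)) atTop (𝓝 0) := by
    simpa using hexp.const_mul (‖v‖ + ‖v'‖)
  have h2 : Tendsto (fun x : ℝ => ‖v'‖ * Real.exp (-c.re) * Real.exp (β.re * x) ^ 2)
      atTop (𝓝 0) := by
    simpa using (hexp.pow 2).const_mul (‖v'‖ * Real.exp (-c.re))
  have hq : (0 : ℝ) < 1 / 4 := by norm_num
  obtain ⟨n, hn1, hn2⟩ := ((htop.eventually (h1.eventually_lt_const hq)).and
    (htop.eventually (h2.eventually_lt_const hq))).exists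
  refine ⟨U n, ?_⟩
  have hL : ‖v' * Complex.exp (conj β * U n)‖ < 1 / 4 := by
    rw [norm_mul, Complex.norm_exp]
    refine lt_of_eq_of_lt ?_ hn2
    have : (conj β * U n).re = -c.re + 2 * (β.re * (U n).re) := by
      rw [← hre' n]; simp; ring
    rw [this, Real.exp_add, two_mul, Real.exp_add]; ring
  have hR : ‖v * Complex.exp (β * (U n).re) + v' * Complex.exp (conj β * (U n).re)‖ < 1 / 4 := by
    refine (norm_add_le _ _).trans_lt (lt_of_eq_of_lt ?_ hn1)
    rw [norm_mul, norm_mul, Complex.norm_exp, Complex.norm_exp]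
    simp; ring
  rw [hUv, add_assoc 1 (v * _)]
  generalize v' * Complex.exp (conj β * U n) = A at *
  generalize v * Complex.exp (β * (U n).re) + v' * Complex.exp (conj β * (U n).re) = B at *
  have hA : ‖(1 + -1 / 2 : ℂ) + A‖ ≤ 1 / 2 + ‖A‖ := by
    refine (norm_add_le _ _).trans_eq ?_
    norm_num
  have hB : 1 - ‖B‖ ≤ ‖1 + B‖ := by
    have := norm_sub_le (1 + B) B
    rw [add_sub_cancel_right, norm_one] at this
    linarith
  linarith

/-! ### Three reciprocal zeros of equal modulus -/

/-- The logarithmic derivative, with respect to `z`, of a simple root `y` of `recipCubic a b z`. -/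
noncomputable def logSlope (a b : ℝ) (z y : ℂ) : ℂ :=
  (b * y + 1) / (y * (3 * y ^ 2 - 2 * y + (a - b * z)))

theorem recipCubic_deriv_eq {a b : ℝ} {z y₁ y₂ y₃ : ℂ} (h₁₂ : y₁ ≠ y₂) (h₁₃ : y₁ ≠ y₃)
    (h₂₃ : y₂ ≠ y₃) (h₁ : recipCubic a b z y₁ = 0) (h₂ : recipCubic a b z y₂ = 0)
    (h₃ : recipCubic a b z y₃ = 0) :
    3 * y₁ ^ 2 - 2 * y₁ + (a - b * z) = (y₁ - y₂) * (y₁ - y₃) := by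
  obtain ⟨d₁₂, hs⟩ := recipCubic_vieta h₁₂ h₁₃ h₂₃ h₁ h₂ h₃
  linear_combination d₁₂ + (y₁ - y₂) * hs

/-- At a real `z` with three distinct reciprocal zeros of modulus `ρ`, the rescaled polynomials
`u ↦ H_m(z + u / m) / ρ ^ m` converge along a subsequence of `m` to an exponential sum, which
inherits the inequality of `norm_aeval_re_le`. -/
theorem expSum_norm_re_le {a b z ρ : ℝ} {y₁ y₂ y₃ : ℂ} (hρ : 0 < ρ)
    (hreal : ∀ m : ℕ, ∀ w : ℂ, aeval w (polyH a b m) = 0 → w.im = 0)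
    (h₁₂ : y₁ ≠ y₂) (h₁₃ : y₁ ≠ y₃) (h₂₃ : y₂ ≠ y₃)
    (h₁ : recipCubic a b z y₁ = 0) (h₂ : recipCubic a b z y₂ = 0) (h₃ : recipCubic a b z y₃ = 0)
    (hn₁ : ‖y₁‖ = ρ) (hn₂ : ‖y₂‖ = ρ) (hn₃ : ‖y₃‖ = ρ) :
    ∃ C₁ C₂ C₃ : ℂ, C₁ ≠ 0 ∧ C₂ ≠ 0 ∧ C₃ ≠ 0 ∧ ∀ u : ℂ,
      ‖C₁ * Complex.exp (logSlope a b z y₁ * u.re) + C₂ * Complex.exp (logSlope a b z y₂ * u.re)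
        + C₃ * Complex.exp (logSlope a b z y₃ * u.re)‖ ≤
      ‖C₁ * Complex.exp (logSlope a b z y₁ * u) + C₂ * Complex.exp (logSlope a b z y₂ * u)
        + C₃ * Complex.exp (logSlope a b z y₃ * u)‖ := by
  have hy : ∀ {y : ℂ}, ‖y‖ = ρ → y ≠ 0 := fun h => norm_pos_iff.1 (h ▸ hρ)
  have hρc : (ρ : ℂ) ≠ 0 := Complex.ofReal_ne_zero.2 hρ.ne'
  have hmem : ∀ {y : ℂ}, ‖y‖ = ρ → ∀ m : ℕ, (y / ρ) ^ m ∈ Metric.sphere (0 : ℂ) 1 := by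
    intro y h m
    rw [mem_sphere_zero_iff_norm, norm_pow, norm_div, h, Complex.norm_real, Real.norm_eq_abs,
      abs_of_pos hρ, div_self hρ.ne', one_pow]
  -- a subsequence along which the unimodular factors `(y / ρ) ^ m` converge
  have hcpt := (isCompact_sphere (0 : ℂ) 1).prod
    ((isCompact_sphere (0 : ℂ) 1).prod (isCompact_sphere (0 : ℂ) 1))
  obtain ⟨⟨W₁, W₂, W₃⟩, ⟨hW₁, hW₂, hW₃⟩, φ, hφ, hW⟩ := hcpt.tendsto_subseq
    (x := fun m => ((y₁ / ρ) ^ m, (y₂ / ρ) ^ m, (y₃ / ρ) ^ m))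
    fun m => ⟨hmem hn₁ m, hmem hn₂ m, hmem hn₃ m⟩
  have hW1 : Tendsto (fun n => (y₁ / ρ) ^ φ n) atTop (𝓝 W₁) := hW.fst_nhds
  have hW2 : Tendsto (fun n => (y₂ / ρ) ^ φ n) atTop (𝓝 W₂) := hW.snd_nhds.fst_nhds
  have hW3 : Tendsto (fun n => (y₃ / ρ) ^ φ n) atTop (𝓝 W₃) := hW.snd_nhds.snd_nhds
  have hne : ∀ {W : ℂ}, W ∈ Metric.sphere (0 : ℂ) 1 → W ≠ 0 := fun h =>
    Metric.ne_of_mem_sphere h one_ne_zero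
  have hF₁ : 3 * y₁ ^ 2 - 2 * y₁ + (a - b * z) ≠ 0 := by
    rw [recipCubic_deriv_eq h₁₂ h₁₃ h₂₃ h₁ h₂ h₃]
    exact mul_ne_zero (sub_ne_zero.2 h₁₂) (sub_ne_zero.2 h₁₃)
  have hF₂ : 3 * y₂ ^ 2 - 2 * y₂ + (a - b * z) ≠ 0 := by
    rw [recipCubic_deriv_eq h₁₂.symm h₂₃ h₁₃ h₂ h₁ h₃]
    exact mul_ne_zero (sub_ne_zero.2 h₁₂.symm) (sub_ne_zero.2 h₂₃)
  have hF₃ : 3 * y₃ ^ 2 - 2 * y₃ + (a - b * z) ≠ 0 := by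
    rw [recipCubic_deriv_eq h₁₃.symm h₂₃.symm h₁₂ h₃ h₁ h₂]
    exact mul_ne_zero (sub_ne_zero.2 h₁₃.symm) (sub_ne_zero.2 h₂₃.symm)
  set V := (y₁ - y₂) * (y₁ - y₃) * (y₂ - y₃) with hV
  have hV0 : V ≠ 0 := mul_ne_zero (mul_ne_zero (sub_ne_zero.2 h₁₂) (sub_ne_zero.2 h₁₃))
    (sub_ne_zero.2 h₂₃)
  set E : ℂ → ℂ := fun u =>
    W₁ * (y₁ ^ 2 * (y₂ - y₃)) * Complex.exp (logSlope a b z y₁ * u)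
      + W₂ * (-(y₂ ^ 2 * (y₁ - y₃))) * Complex.exp (logSlope a b z y₂ * u)
      + W₃ * (y₃ ^ 2 * (y₁ - y₂)) * Complex.exp (logSlope a b z y₃ * u) with hE
  have hlim : ∀ u : ℂ, Tendsto (fun n => ‖aeval (z + u / φ n : ℂ) (polyH a b (φ n))‖ / ρ ^ φ n)
      atTop (𝓝 (‖E u‖ / ‖V‖)) := by
    intro u
    obtain ⟨ξ₁, hr₁, ht₁, he₁⟩ := exists_tendsto_recipCubic_root a b z y₁ u h₁ (hy hn₁) hF₁
    obtain ⟨ξ₂, hr₂, ht₂, he₂⟩ := exists_tendsto_recipCubic_root a b z y₂ u h₂ (hy hn₂) hF₂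
    obtain ⟨ξ₃, hr₃, ht₃, he₃⟩ := exists_tendsto_recipCubic_root a b z y₃ u h₃ (hy hn₃) hF₃
    have hφt := hφ.tendsto_atTop
    have hN := (((((he₁.comp hφt).mul hW1).mul ((ht₁.comp hφt).pow 2)).mul
      ((ht₂.sub ht₃).comp hφt)).sub ((((he₂.comp hφt).mul hW2).mul ((ht₂.comp hφt).pow 2)).mul
      ((ht₁.sub ht₃).comp hφt))).add ((((he₃.comp hφt).mul hW3).mul ((ht₃.comp hφt).pow 2)).mul
      ((ht₁.sub ht₂).comp hφt))
    have hVt := (((ht₁.sub ht₂).mul (ht₁.sub ht₃)).mul (ht₂.sub ht₃)).comp hφt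
    have hquot := hN.norm.div hVt.norm (norm_ne_zero_iff.2 hV0)
    refine (hquot.congr' ?_).trans_eq ?_
    · filter_upwards [hφt.eventually ((ht₁.sub ht₂).eventually_ne (sub_ne_zero.2 h₁₂)),
        hφt.eventually ((ht₁.sub ht₃).eventually_ne (sub_ne_zero.2 h₁₃)),
        hφt.eventually ((ht₂.sub ht₃).eventually_ne (sub_ne_zero.2 h₂₃))] with n g₁₂ g₁₃ g₂₃
      have key := aeval_polyH_of_roots a b (z + u / φ n) (ξ₁ (φ n)) (ξ₂ (φ n)) (ξ₃ (φ n))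
        (sub_ne_zero.1 g₁₂) (sub_ne_zero.1 g₁₃) (sub_ne_zero.1 g₂₃) (hr₁ _) (hr₂ _) (hr₃ _) (φ n)
      simp only [Function.comp_apply, Pi.div_apply]
      have hvn := norm_pos_iff.2 (mul_ne_zero (mul_ne_zero g₁₂ g₁₃) g₂₃)
      have y1 := hy hn₁
      have y2 := hy hn₂
      have y3 := hy hn₃
      have hsc : ∀ {ξ y : ℂ}, y ≠ 0 → (ξ / y) ^ φ n * (y / ρ) ^ φ n * ξ ^ 2 =
          ξ ^ (φ n + 2) / ρ ^ φ n := by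
        intro ξ y hy
        rw [← mul_pow, div_mul_div_cancel₀ hy, div_pow, pow_add]; ring
      rw [div_eq_div_iff hvn.ne' (by positivity), hsc y1, hsc y2, hsc y3, mul_comm ‖aeval _ _‖,
        ← norm_mul, key, norm_mul, norm_pow, norm_neg, norm_one, one_pow, one_mul]
      have hρn : ‖(ρ : ℂ) ^ φ n‖ = ρ ^ φ n := by
        rw [norm_pow, Complex.norm_real, Real.norm_eq_abs, abs_of_pos hρ]
      rw [← hρn, ← norm_mul]
      congr 1
      have := pow_ne_zero (φ n) hρc
      field_simp
    · congr 3
      simp only [hE, logSlope]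
      ring
  refine ⟨W₁ * (y₁ ^ 2 * (y₂ - y₃)), W₂ * (-(y₂ ^ 2 * (y₁ - y₃))), W₃ * (y₃ ^ 2 * (y₁ - y₂)),
    mul_ne_zero (hne hW₁) (mul_ne_zero (pow_ne_zero 2 (hy hn₁)) (sub_ne_zero.2 h₂₃)),
    mul_ne_zero (hne hW₂) (neg_ne_zero.2 (mul_ne_zero (pow_ne_zero 2 (hy hn₂))
      (sub_ne_zero.2 h₁₃))),
    mul_ne_zero (hne hW₃) (mul_ne_zero (pow_ne_zero 2 (hy hn₃)) (sub_ne_zero.2 h₁₂)),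
    fun u => ?_⟩
  have hle : ‖E u.re‖ / ‖V‖ ≤ ‖E u‖ / ‖V‖ := by
    refine le_of_tendsto_of_tendsto' (hlim u.re) (hlim u) fun n => ?_
    refine div_le_div_of_nonneg_right ?_ (by positivity)
    have := norm_aeval_re_le (hreal (φ n)) (z + u / φ n)
    rw [Complex.add_re, Complex.ofReal_re, Complex.div_natCast_re] at this
    push_cast at this
    exact this
  exact (div_le_div_iff_of_pos_right (norm_pos_iff.2 hV0)).1 hle

/-- The limiting exponential sum of a conjugate pair and a real reciprocal zero contradicts
`exists_exp_sum_norm_lt` after division by its real exponential. -/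
theorem not_all_real_of_equimodular {a b z ρ y₃ : ℝ} {y : ℂ} (hρ : 0 < ρ)
    (him : y.im ≠ 0) (h : recipCubic a b z y = 0) (h₃ : recipCubic a b z y₃ = 0)
    (hn : ‖y‖ = ρ) (hn₃ : |y₃| = ρ) (hre : (logSlope a b z y).re < (logSlope a b z y₃).re)
    (hsl : (logSlope a b z y).im ≠ 0) :
    ¬ ∀ m : ℕ, ∀ w : ℂ, aeval w (polyH a b m) = 0 → w.im = 0 := by
  intro hreal
  have hconj : recipCubic a b z (conj y) = 0 := by
    have := congrArg conj h
    unfold recipCubic at this ⊢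
    simpa using this
  have hslc : logSlope a b z (conj y) = conj (logSlope a b z y) := by
    unfold logSlope; simp [map_ofNat (starRingEnd ℂ)]
  obtain ⟨t, ht⟩ : ∃ t : ℝ, logSlope a b z y₃ = t :=
    ⟨(b * y₃ + 1) / (y₃ * (3 * y₃ ^ 2 - 2 * y₃ + (a - b * z))), by unfold logSlope; push_cast; rfl⟩
  have h12 : y ≠ conj y := fun e => him (Complex.conj_eq_iff_im.1 e.symm)
  have h13 : y ≠ y₃ := by rintro rfl; simp at him
  have h23 : conj y ≠ y₃ := by
    intro e
    have := congrArg Complex.im e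
    simp at this
    exact him this
  obtain ⟨C₁, C₂, C₃, hC₁, hC₂, hC₃, hE⟩ := expSum_norm_re_le hρ hreal h12 h13 h23 h hconj h₃ hn
    (by rw [RCLike.norm_conj, hn]) (by rw [Complex.norm_real, Real.norm_eq_abs, hn₃])
  rw [hslc, ht] at hE
  rw [ht, Complex.ofReal_re] at hre
  set α := logSlope a b z y with hα
  have hfac : ∀ u : ℂ, C₁ * Complex.exp (α * u) + C₂ * Complex.exp (conj α * u)
      + C₃ * Complex.exp (t * u) = C₃ * Complex.exp (t * u) *
        (1 + C₁ / C₃ * Complex.exp ((α - t) * u) + C₂ / C₃ * Complex.exp (conj (α - t) * u)) := by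
    intro u
    have e1 : Complex.exp (α * u) = Complex.exp (t * u) * Complex.exp ((α - t) * u) := by
      rw [← Complex.exp_add]; congr 1; ring
    have e2 : Complex.exp (conj α * u) = Complex.exp (t * u) * Complex.exp (conj (α - t) * u) := by
      rw [← Complex.exp_add, map_sub, Complex.conj_ofReal]; congr 1; ring
    rw [e1, e2]
    field_simp
    ring
  obtain ⟨u, hu⟩ := exists_exp_sum_norm_lt (v := C₁ / C₃) (v' := C₂ / C₃) (β := α - t)
    (div_ne_zero hC₁ hC₃) (by simpa using hre) (by simpa using hsl)
  have := hE u
  rw [hfac, hfac, norm_mul, norm_mul, norm_mul, norm_mul, Complex.norm_exp, Complex.norm_exp,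
    Complex.re_ofReal_mul, Complex.re_ofReal_mul, Complex.ofReal_re] at this
  have hpos : 0 < ‖C₃‖ * Real.exp (t * u.re) := mul_pos (norm_pos_iff.2 hC₃) (Real.exp_pos _)
  exact absurd (le_of_mul_le_mul_left this hpos) (not_le.2 hu)

/-! ### Necessity of the conditions -/

/-- The hypotheses say that `e ^ (± i φ) / r` and `η / r`, with `η = ± 1` and
`cos φ = (r - η) / 2`, are the reciprocal zeros for the real number `z = η / r ^ 3`. The inequality
between the logarithmic derivatives reduces to `0 < 3 b + r ^ 2`. -/
theorem not_all_real_of_param {a b r η : ℝ} (hb : 0 ≤ b) (hr : 0 < r) (hη : η ^ 2 = 1)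
    (hr1 : η - 2 < r) (hr2 : r < η + 2) (h : r ^ 2 + b = η * a * r ^ 3) :
    ¬ ∀ m : ℕ, ∀ w : ℂ, aeval w (polyH a b m) = 0 → w.im = 0 := by
  obtain ⟨s, hs⟩ : ∃ s, s = (r - η) / 2 := ⟨_, rfl⟩
  have hs2 : 0 < 1 - s ^ 2 := by
    have : 0 < (1 - s) * (1 + s) := mul_pos (by linarith) (by linarith)
    linarith
  obtain ⟨S, hS⟩ : ∃ S, S = Real.sqrt (1 - s ^ 2) := ⟨_, rfl⟩
  have hS0 : 0 < S := hS ▸ Real.sqrt_pos.2 hs2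
  have hSs : S ^ 2 = 1 - s ^ 2 := hS ▸ Real.sq_sqrt hs2.le
  have hrc : (r : ℂ) ≠ 0 := Complex.ofReal_ne_zero.2 hr.ne'
  have hSc : (S : ℂ) ≠ 0 := Complex.ofReal_ne_zero.2 hS0.ne'
  have hηc : (η : ℂ) ^ 2 = 1 := by exact_mod_cast hη
  have hη' : (η : ℂ) = 1 ∨ (η : ℂ) = -1 := sq_eq_one_iff.1 hηc
  have hSsc : (S : ℂ) ^ 2 = 1 - s ^ 2 := by exact_mod_cast hSs
  have hrs : (r : ℂ) = 2 * s + η := by rw [hs]; push_cast; ring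
  have hη1 : |η| = 1 := by rwa [← sq_eq_sq₀ (abs_nonneg _) zero_le_one, sq_abs, one_pow]
  have hT : 0 < 3 - η * r := by
    -- the left side is `|η - e ^ (i φ)| ^ 2`
    have h1 : (η - s) ^ 2 + (1 - s ^ 2) = 3 - η * r := by
      rw [show r = 2 * s + η by rw [hs]; ring]; linear_combination 2 * hη
    rw [← h1]; positivity
  obtain ⟨e, he⟩ : ∃ e : ℂ, e = s + S * Complex.I := ⟨_, rfl⟩
  have hee : e ^ 2 = 2 * s * e - 1 := by
    rw [he]; linear_combination -hSsc + (S : ℂ) ^ 2 * Complex.I_sq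
  have hab : (a : ℂ) - b * (η / r ^ 3 : ℝ) = η / r := by
    have : a - b * (η / r ^ 3) = η / r := by
      field_simp; linear_combination -η * h - a * r ^ 3 * hη
    exact_mod_cast this
  have hnorm : ‖e‖ = 1 := by
    have : ‖e‖ ^ 2 = 1 := by
      rw [Complex.sq_norm, Complex.normSq_apply, he]; simp; linear_combination hSs
    rwa [← sq_eq_sq₀ (norm_nonneg _) zero_le_one, one_pow]
  have hcub : ∀ y : ℂ, (y - η) * (y ^ 2 - 2 * s * y + 1) = 0 →
      recipCubic a b (η / r ^ 3 : ℝ) (y / r) = 0 := by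
    intro y hy
    rw [recipCubic, hab]
    push_cast
    field_simp
    rw [hrs]
    linear_combination hy + y * hηc
  have hslope : ∀ y : ℂ, y ≠ 0 → logSlope a b (η / r ^ 3 : ℝ) (y / r) =
      r ^ 2 * ((b * y + r) / (y * (3 * y ^ 2 - 2 * r * y + η * r))) := by
    intro y hy
    rw [logSlope, hab]
    have : 3 * (y / r) ^ 2 - 2 * (y / r) + η / r = (3 * y ^ 2 - 2 * r * y + η * r) / r ^ 2 := by
      field_simp
    rw [this, show b * (y / r) + 1 = (b * y + r) / (r : ℂ) by field_simp]
    generalize 3 * y ^ 2 - 2 * r * y + η * r = D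
    rcases eq_or_ne D 0 with rfl | hD
    · simp
    · field_simp
  have hsl₃ : logSlope a b (η / r ^ 3 : ℝ) ((η / r : ℝ) : ℂ) =
      (r ^ 2 * ((b + η * r) / (3 - η * r)) : ℝ) := by
    have hη0 : (η : ℂ) ≠ 0 := by rintro h; simp [h] at hηc
    rw [Complex.ofReal_div η r, hslope η hη0]
    push_cast
    congr 1
    rcases hη' with h | h <;> rw [h]
    · congr 1 <;> ring
    · rw [← neg_div_neg_eq]
      congr 1 <;> ring
  have hsl : logSlope a b (η / r ^ 3 : ℝ) (e / r) =
      (r ^ 2 * ((2 * η * r - b - r ^ 2) / (2 * (3 - η * r))) : ℝ) +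
        (r ^ 2 * (η * (b + r ^ 2) / (4 * S)) : ℝ) * Complex.I := by
    have he0 : e ≠ 0 := by rintro h; simp [h] at hnorm
    have hTc : (3 - η * r : ℂ) ≠ 0 := by exact_mod_cast hT.ne'
    have hSI : S * Complex.I = e - s := by rw [he]; ring
    have hsc : (s : ℂ) = (r - η) / 2 := by rw [hs]; push_cast; ring
    have hee' : e ^ 2 = (r - η) * e - 1 := by rw [hee, hsc]; ring
    have hD : e * (3 * e ^ 2 - 2 * r * e + η * r) = 2 * (S * Complex.I) * ((r - 2 * η) * e - 1) := by
      rw [hSI, hsc]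
      rcases hη' with h | h <;> rw [h] at hee' ⊢
      · linear_combination (3 * e + 1 - r) * hee'
      · linear_combination (3 * e - 1 - r) * hee'
    have hmain : (3 - η * r) * (b * e + r) = ((e - s) * (2 * η * r - b - r ^ 2)
        - (3 - η * r) * (η * (b + r ^ 2)) / 2) * ((r - 2 * η) * e - 1) := by
      rw [hsc]
      rcases hη' with h | h <;> rw [h] at hee' ⊢
      · linear_combination -(2 * r - b - r ^ 2) * (r - 2) * hee'
      · linear_combination -(-2 * r - b - r ^ 2) * (r + 2) * hee'
    have hne : (r - 2 * η) * e - 1 ≠ 0 := by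
      intro h0
      have him := congrArg Complex.im h0
      simp [he, hS0.ne'] at him
      have : (r : ℂ) - 2 * η = 0 := by exact_mod_cast him
      simp [this] at h0
    rw [hslope e he0, hD]
    push_cast
    rw [mul_assoc ((r : ℂ) ^ 2), ← mul_add]
    congr 1
    rw [div_eq_iff (by simp [hSc, hne]), ← mul_right_inj' hTc, hmain, ← hSI]
    field_simp
    linear_combination (-4 * (3 - η * r) * η * (b + r ^ 2)) * Complex.I_sq
  have hre : (e / r).im = S / r := by
    rw [he, Complex.div_ofReal_im]; simp
  refine not_all_real_of_equimodular (z := η / r ^ 3) (y₃ := η / r) (y := e / r) (ρ := 1 / r)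
    (by positivity) ?_ ?_ ?_ ?_ ?_ ?_ ?_
  · rw [hre]; positivity
  · exact hcub e (by rw [hee]; ring)
  · push_cast
    have := hcub η (by rw [sub_self, zero_mul])
    push_cast at this
    exact this
  · rw [norm_div, hnorm, Complex.norm_real, Real.norm_eq_abs, abs_of_pos hr]
  · rw [abs_div, hη1, abs_of_pos hr]
  · rw [hsl, hsl₃, Complex.add_re, Complex.ofReal_re, Complex.re_ofReal_mul, Complex.ofReal_re,
      Complex.I_re, mul_zero, add_zero]
    refine mul_lt_mul_of_pos_left ?_ (by positivity)
    rw [div_lt_div_iff₀ (by positivity) hT]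
    have : 0 < (3 * b + r ^ 2) * (3 - η * r) := by positivity
    nlinarith
  · rw [hsl, Complex.add_im, Complex.ofReal_im, Complex.im_ofReal_mul, Complex.I_im, zero_add,
      mul_one]
    have : η ≠ 0 := by rintro rfl; simp at hη1
    positivity

/-- If a condition fails, the intermediate value theorem provides three reciprocal zeros of equal
modulus: `η = -1` and `r ∈ (0, 1)` for the first, `η = 1` and `r ∈ (0, 3)` for the second. -/
theorem cond_of_all_real {a b : ℝ} (hb : 0 ≤ b)
    (hreal : ∀ m : ℕ, ∀ w : ℂ, aeval w (polyH a b m) = 0 → w.im = 0) :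
    0 ≤ 1 + a + b ∧ 0 ≤ 9 - 27 * a + b := by
  constructor
  · by_contra! hlt
    have hcont : Continuous fun r : ℝ => r ^ 2 + b + a * r ^ 3 := by fun_prop
    obtain ⟨δ, hδ0, hδ1, hδ⟩ : ∃ δ : ℝ, 0 < δ ∧ δ < 1 ∧ 0 ≤ δ ^ 2 + b + a * δ ^ 3 := by
      have ha : a < -1 := by linarith
      -- at `-1 / a` the terms other than `b` cancel
      refine ⟨-1 / a, by rw [neg_div, ← div_neg]; apply div_pos one_pos; linarith, ?_, ?_⟩
      · rw [div_lt_one_of_neg (by linarith)]; linarith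
      · have : (-1 / a) ^ 2 + b + a * (-1 / a) ^ 3 = b := by
          have : a ≠ 0 := by linarith
          field_simp; ring
        rwa [this]
    obtain ⟨r, hr, h⟩ := intermediate_value_Ico' hδ1.le hcont.continuousOn
      ⟨by norm_num; linarith, hδ⟩
    exact not_all_real_of_param (η := -1) hb (hδ0.trans_le hr.1) (by norm_num)
      (by linarith [hr.1]) (by linarith [hr.2]) (by dsimp only at h; linear_combination h) hreal
  · by_contra! hlt
    have hcont : Continuous fun r : ℝ => r ^ 2 + b - a * r ^ 3 := by fun_prop
    obtain ⟨δ, hδ0, hδ1, hδ⟩ : ∃ δ : ℝ, 0 < δ ∧ δ < 3 ∧ 0 ≤ δ ^ 2 + b - a * δ ^ 3 := by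
      have ha : 1 / 3 < a := by linarith
      have ha0 : 0 < a := by linarith
      -- at `1 / a` the terms other than `b` cancel
      refine ⟨1 / a, by positivity, ?_, ?_⟩
      · rw [div_lt_iff₀ ha0]; linarith
      · have : (1 / a) ^ 2 + b - a * (1 / a) ^ 3 = b := by
          field_simp; ring
        rwa [this]
    obtain ⟨r, hr, h⟩ := intermediate_value_Ico' hδ1.le hcont.continuousOn
      ⟨by norm_num; linarith, hδ⟩
    exact not_all_real_of_param (η := 1) hb (hδ0.trans_le hr.1) (by norm_num)
      (by linarith [hr.1]) (by linarith [hr.2]) (by dsimp only at h; linear_combination h) hreal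

theorem theorem2 (a b : ℝ) (hb : 0 ≤ b) :
    (∀ m : ℕ, ∀ z : ℂ, Polynomial.aeval z (polyH a b m) = 0 → z.im = 0) ↔
      0 ≤ 1 + a + b ∧ 0 ≤ 9 - 27 * a + b :=
  ⟨cond_of_all_real hb, fun h m _ hz => im_eq_zero_of_aeval_polyH hb h.1 h.2 m hz⟩
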